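/- Let $G$ be a (finite-dimensional, real) Lie group with Lie algebra $\mathfrak g$, and let $\pi: P\to X$ be a smooth principal $G$-bundle over a smooth manifold $X$, with right action $\rho: P\times G\to P$. Let $\mathcal X(X)$ be the space of smooth vector fields on $X$ and $\mathcal X(P)_G$ the space of $G$-invariant smooth vector fields on $P$. Fix an $\mathbb R$-linear lift $\widetilde{(-)}:\mathcal X(X)\to\mathcal X(P)_G$, i.e. an $\mathbb R$-linear map $\xi\mapsto\widetilde\xi$ such that $\mathrm d\pi(\widetilde\xi_p)=\xi_{\pi(p)}$ for all $p\in P$. For a connection $\widetilde\omega$ on $P$, i.e. a smooth form $\widetilde\omega\in\Omega^1(P;\mathfrak g)$ with $\rho_g^*\widetilde\omega=\mathrm{Ad}_{g^{-1}}\widetilde\omega$ for all $g \in G$ and $\widetilde\omega(A^\#)=A$ for the fundamental vector field $A^\#$ of every $A\in\mathfrak g$, put $\widetilde\lambda^{\omega}_\xi:=\iota_{\widetilde\xi}\,\widetilde\omega\in\Omega^0(P;\mathfrak g)$. For a $G$-equivariant local trivialization $P|_{U}\cong U\times G$ over an open set $U\subseteq X$ with canonical local section $\sigma:U\to P$ (corresponding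 to $x\mapsto(x,1)$), let $\omega:=\sigma^*\widetilde\omega\in\Omega^1(U;\mathfrak g)$ and $\lambda^\omega_\xi:=\sigma^*\widetilde\lambda^\omega_\xi\in\Omega^0(U;\mathfrak g)$ denote the local representatives. The covariantization correction term is the family of local functions $\iota_\xi\omega-\lambda^\omega_\xi\in\Omega^0(U;\mathfrak g)$, one for each local trivialization. Then this correction term does not depend on the chosen connection: for any two connections $\widetilde\omega,\widetilde{\hat\omega}$ on $P$, every $\xi\in\mathcal X(X)$ and every local trivialization over $U$, $$\iota_\xi\omega-\lambda^\omega_\xi=\iota_\xi\hat\omega-\lambda^{\hat\omega}_\xi\qquad\text{on } U.$$ -/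

import Mathlib

open scoped Manifold ContDiff Bundle

noncomputable section

namespace GaugeGeometry

section Basic

variable {EX HX X EG HG G EP HP P : Type*}
  [NormedAddCommGroup EX] [NormedSpace ℝ EX] [TopologicalSpace HX]
  (IX : ModelWithCorners ℝ EX HX)
  [TopologicalSpace X] [ChartedSpace HX X]
  [NormedAddCommGroup EG] [NormedSpace ℝ EG] [TopologicalSpace HG]
  (IG : ModelWithCorners ℝ EG HG)
  [TopologicalSpace G] [ChartedSpace HG G] [Group G]
  [NormedAddCommGroup EP] [NormedSpace ℝ EP] [TopologicalSpace HP]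
  (IP : ModelWithCorners ℝ EP HP)
  [TopologicalSpace P] [ChartedSpace HP P]

/-- A smooth `G`-equivariant local trivialization `P|_U ≅ U × G` of a map `proj : P → X`, where
`act p g` is the right action `p · g` of `G` on `P` and `G` acts on `U × G` by right multiplication
on the second factor. The open set `U` is `baseSet`. -/
structure PrincipalTrivialization (proj : P → X) (act : P → G → P)
    extends Bundle.Trivialization G proj where
  /-- The trivialization is smooth on `P|_U`. -/
  contMDiffOn_toFun : ContMDiffOn IP (IX.prod IG) ∞ toFun source
  /-- Its inverse is smooth on `U × G`. -/
  contMDiffOn_invFun : ContMDiffOn (IX.prod IG) IP ∞ invFun target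
  /-- The trivialization is `G`-equivariant. -/
  map_act : ∀ p ∈ source, ∀ g : G, toFun (act p g) = ((toFun p).1, (toFun p).2 * g)

/-- The canonical local section `σ : U → P`, `σ x = φ⁻¹ (x, 1)`, of a local trivialization
`φ : P|_U ≅ U × G` (its values outside `U` are irrelevant). -/
def PrincipalTrivialization.localSection {IX : ModelWithCorners ℝ EX HX}
    {IG : ModelWithCorners ℝ EG HG} {IP : ModelWithCorners ℝ EP HP}
    {proj : P → X} {act : P → G → P}
    (φ : PrincipalTrivialization IX IG IP proj act) : X → P :=
  fun x ↦ φ.invFun (x, 1)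

variable (X G P) in
/-- A smooth principal `G`-bundle structure `P → X`: a smooth projection and a smooth right action
of `G` on `P` preserving the fibres, with smooth equivariant local trivializations. -/
structure PrincipalBundle where
  /-- The bundle projection `π : P → X`. -/
  proj : P → X
  /-- The right action `p · g`. -/
  act : P → G → P
  act_one : ∀ p, act p 1 = p
  act_mul : ∀ p g h, act p (g * h) = act (act p g) h
  proj_act : ∀ p g, proj (act p g) = proj p
  contMDiff_proj : ContMDiff IP IX ∞ proj
  contMDiff_act : ContMDiff (IP.prod IG) IP ∞ (fun q : P × G ↦ act q.1 q.2)
  locally_trivial : ∀ x : X, ∃ φ : PrincipalTrivialization IX IG IP proj act, x ∈ φ.baseSet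

variable (X) in
/-- The space `𝒳(X)` of smooth vector fields on a manifold `X`, a real vector space. -/
abbrev SmoothVectorField [IsManifold IX ∞ X] : Type _ :=
  Cₛ^∞⟮IX; EX, (TangentSpace IX : X → Type _)⟯

/-- The adjoint action `Ad g : 𝔤 → 𝔤`, the differential at `1` of `h ↦ g h g⁻¹`. -/
def adjointAction (g : G) : GroupLieAlgebra IG G →L[ℝ] GroupLieAlgebra IG G :=
  mfderiv IG IG (fun h : G ↦ g * h * g⁻¹) 1

end Basic

section Bundle

variable {EX HX X EG HG G EP HP P : Type*}
  [NormedAddCommGroup EX] [NormedSpace ℝ EX] [TopologicalSpace HX]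
  {IX : ModelWithCorners ℝ EX HX}
  [TopologicalSpace X] [ChartedSpace HX X] [IsManifold IX ∞ X]
  [NormedAddCommGroup EG] [NormedSpace ℝ EG] [TopologicalSpace HG]
  {IG : ModelWithCorners ℝ EG HG}
  [TopologicalSpace G] [ChartedSpace HG G] [Group G]
  [NormedAddCommGroup EP] [NormedSpace ℝ EP] [TopologicalSpace HP]
  {IP : ModelWithCorners ℝ EP HP}
  [TopologicalSpace P] [ChartedSpace HP P] [IsManifold IP ∞ P]

namespace PrincipalBundle

variable (B : PrincipalBundle X G P IX IG IP)

/-- The smooth equivariant local trivializations of the principal bundle. -/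
abbrev LocalTrivialization : Type _ := PrincipalTrivialization IX IG IP B.proj B.act

/-- The value at `p` of the fundamental vector field `A^#`: the differential at `1 ∈ G` of the orbit
map `g ↦ p · g`, applied to `A ∈ 𝔤`. -/
def fundamentalVectorField (A : GroupLieAlgebra IG G) (p : P) : TangentSpace IP p :=
  (mfderiv IG IP (fun g : G ↦ B.act p g) 1 :
    GroupLieAlgebra IG G →L[ℝ] TangentSpace IP (B.act p 1)) A

/-- The space `𝒳(P)_G` of `G`-invariant smooth vector fields on `P`:
`(d ρ_g)_p (Z p) = Z (p · g)`, where `ρ_g p = p · g`. -/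
def invariantVectorFields : Submodule ℝ (SmoothVectorField P IP) where
  carrier := {Z | ∀ (g : G) (p : P),
    mfderiv IP IP (fun q : P ↦ B.act q g) p (Z p) = Z (B.act p g)}
  add_mem' := by
    intro Z W hZ hW g p
    change mfderiv IP IP (fun q : P ↦ B.act q g) p (Z p + W p) = Z (B.act p g) + W (B.act p g)
    rw [map_add, hZ, hW]
  zero_mem' := by
    intro g p
    exact map_zero (mfderiv IP IP (fun q : P ↦ B.act q g) p)
  smul_mem' := by
    intro c Z hZ g p
    change mfderiv IP IP (fun q : P ↦ B.act q g) p (c • Z p) = c • Z (B.act p g)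
    rw [map_smul, hZ]

/-- An `ℝ`-linear lift `𝒳(X) → 𝒳(P)_G`, `ξ ↦ ξ̃`, of vector fields on the base to `G`-invariant vector
fields on the total space: `dπ (ξ̃ p) = ξ (π p)`. -/
structure LinearLift where
  /-- The underlying linear map. -/
  toLinearMap : SmoothVectorField X IX →ₗ[ℝ] B.invariantVectorFields
  /-- `ξ̃` projects to `ξ`. -/
  mfderiv_proj : ∀ (ξ : SmoothVectorField X IX) (p : P),
    mfderiv IP IX B.proj p ((toLinearMap ξ : SmoothVectorField P IP) p) = ξ (B.proj p)

/-- A connection on the principal bundle: a smooth, `G`-equivariant `𝔤`-valued `1`-form `ω` on `P`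
with `ω (A^#) = A` for all `A ∈ 𝔤`. -/
structure Connection where
  /-- The `1`-form. -/
  form : ∀ p : P, TangentSpace IP p →L[ℝ] GroupLieAlgebra IG G
  /-- Smoothness, as a section of the bundle of continuous linear maps from `TP` to the trivial
  bundle with fibre `𝔤` (the tangent space `𝔤` of `G` at `1` is the model space `EG`). -/
  contMDiff_form : ContMDiff IP (IP.prod 𝓘(ℝ, EP →L[ℝ] EG)) ∞
    (fun p ↦ Bundle.TotalSpace.mk' (EP →L[ℝ] EG)
      (E := fun p : P ↦ TangentSpace IP p →L[ℝ] Bundle.Trivial P EG p) p (form p))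
  /-- `ρ_g^* ω = Ad g⁻¹ ∘ ω`. -/
  equivariant : ∀ (g : G) (p : P) (v : TangentSpace IP p),
    form (B.act p g) (mfderiv IP IP (fun q : P ↦ B.act q g) p v) =
      adjointAction IG g⁻¹ (form p v)
  /-- `ω (A^#) = A`. -/
  fundamental : ∀ (A : GroupLieAlgebra IG G) (p : P),
    form p (B.fundamentalVectorField A p) = A

variable {B}

/-- The local gauge field `ω_φ = σ_φ^* ω ∈ Ω¹(U; 𝔤)` of a connection in a local trivialization `φ`
over `U` with canonical local section `σ_φ`. It is meaningful at the points of `U`. -/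
def Connection.gaugeField (θ : B.Connection) (φ : B.LocalTrivialization) (x : X) :
    TangentSpace IX x →L[ℝ] GroupLieAlgebra IG G :=
  (θ.form (φ.localSection x)).comp (mfderiv IX IP φ.localSection x)

/-- The `𝔤`-valued function `λ̃^ω_ξ = ι_ξ̃ ω` on the total space `P`. -/
def LinearLift.totalGaugeParameter (L : B.LinearLift) (θ : B.Connection)
    (ξ : SmoothVectorField X IX) (p : P) : GroupLieAlgebra IG G :=
  θ.form p ((L.toLinearMap ξ : SmoothVectorField P IP) p)

/-- The local representative `(λ^ω_ξ)_φ = σ_φ^* λ̃^ω_ξ` of the section `λ^ω_ξ` of the adjoint bundle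
`P ×_G 𝔤` in a local trivialization `φ`. It is meaningful at the points of `U`. -/
def LinearLift.gaugeParameter (L : B.LinearLift) (θ : B.Connection)
    (ξ : SmoothVectorField X IX) (φ : B.LocalTrivialization) (x : X) : GroupLieAlgebra IG G :=
  L.totalGaugeParameter θ ξ (φ.localSection x)

/-- The covariantization correction term `(ι_ξ ω - λ^ω_ξ)_φ` in a local trivialization `φ` over `U`.
It is meaningful at the points of `U`. -/
def LinearLift.correctionTerm (L : B.LinearLift) (θ : B.Connection)
    (ξ : SmoothVectorField X IX) (φ : B.LocalTrivialization) (x : X) : GroupLieAlgebra IG G :=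
  θ.gaugeField φ x (ξ x) - L.gaugeParameter θ ξ φ x

end PrincipalBundle

end Bundle

end GaugeGeometry

end

namespace GaugeGeometry

section

variable {EX HX X EG HG G EP HP P : Type*}
  [NormedAddCommGroup EX] [NormedSpace ℝ EX] [TopologicalSpace HX]
  {IX : ModelWithCorners ℝ EX HX}
  [TopologicalSpace X] [ChartedSpace HX X]
  [NormedAddCommGroup EG] [NormedSpace ℝ EG] [TopologicalSpace HG]
  {IG : ModelWithCorners ℝ EG HG}
  [TopologicalSpace G] [ChartedSpace HG G] [Group G]
  [NormedAddCommGroup EP] [NormedSpace ℝ EP] [TopologicalSpace HP]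
  {IP : ModelWithCorners ℝ EP HP}
  [TopologicalSpace P] [ChartedSpace HP P]

namespace PrincipalTrivialization

variable {proj : P → X} {act : P → G → P} (φ : PrincipalTrivialization IX IG IP proj act)

/-! By linearity the correction term at `x` is the connection form evaluated on `dσ (ξ x) - ξ̃ (σ
x)`, a vector chosen without reference to the connection. Both of its terms project to `ξ x`, so it
is vertical (`mfderiv_proj_sub`). A vertical vector at `σ x` is the value there of a fundamental
field `A^#` (`exists_mfderiv_act_eq`), and every connection sends that value to `A`. -/

theorem mem_target_of_mem_baseSet {x : X} (hx : x ∈ φ.baseSet) (g : G) : (x, g) ∈ φ.target := by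
  rw [φ.target_eq]
  exact ⟨hx, Set.mem_univ g⟩

theorem localSection_mem_source {x : X} (hx : x ∈ φ.baseSet) : φ.localSection x ∈ φ.source :=
  φ.map_target' (φ.mem_target_of_mem_baseSet hx 1)

theorem toFun_localSection {x : X} (hx : x ∈ φ.baseSet) :
    φ.toFun (φ.localSection x) = (x, 1) :=
  φ.right_inv' (φ.mem_target_of_mem_baseSet hx 1)

theorem proj_localSection {x : X} (hx : x ∈ φ.baseSet) : proj (φ.localSection x) = x := by
  have h : (φ.toFun (φ.localSection x)).1 = proj (φ.localSection x) :=
    φ.proj_toFun _ (φ.localSection_mem_source hx)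
  rw [← h, φ.toFun_localSection hx]

theorem mdifferentiableAt_toFun {p : P} (hp : p ∈ φ.source) :
    MDifferentiableAt IP (IX.prod IG) φ.toFun p :=
  ((φ.contMDiffOn_toFun p hp).contMDiffAt (φ.open_source.mem_nhds hp)).mdifferentiableAt
    (by simp)

theorem mdifferentiableAt_invFun {x : X} (hx : x ∈ φ.baseSet) (g : G) :
    MDifferentiableAt (IX.prod IG) IP φ.invFun (x, g) :=
  have h := φ.mem_target_of_mem_baseSet hx g
  ((φ.contMDiffOn_invFun _ h).contMDiffAt (φ.open_target.mem_nhds h)).mdifferentiableAt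
    (by simp)

theorem mdifferentiableAt_localSection {x : X} (hx : x ∈ φ.baseSet) :
    MDifferentiableAt IX IP φ.localSection x :=
  (φ.mdifferentiableAt_invFun hx 1).comp x
    (mdifferentiableAt_id.prodMk mdifferentiableAt_const)

/-- The orbit map through a point of the local section is a vertical slice of the inverse
trivialization, provided the action preserves fibres. -/
theorem act_localSection (hact : ∀ p g, proj (act p g) = proj p) {x : X} (hx : x ∈ φ.baseSet)
    (g : G) : act (φ.localSection x) g = φ.invFun (x, g) := by
  have hs := φ.localSection_mem_source hx
  -- `left_inv'` holds only on `source`; fibre preservation keeps the orbit of `σ x` inside it.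
  have hag : act (φ.localSection x) g ∈ φ.source := by
    rw [φ.source_eq, Set.mem_preimage, hact, φ.proj_localSection hx]
    exact hx
  have h := φ.map_act _ hs g
  rw [φ.toFun_localSection hx, one_mul] at h
  rw [← h]
  exact (φ.left_inv' hag).symm

/-- The local section is a section, infinitesimally. -/
theorem mfderiv_proj_mfderiv_localSection {x : X} (hx : x ∈ φ.baseSet)
    (hproj : MDifferentiableAt IP IX proj (φ.localSection x)) (u : TangentSpace IX x) :
    (mfderiv IP IX proj (φ.localSection x) (mfderiv IX IP φ.localSection x u) : EX) = u := by
  have hcomp := mfderiv_comp x hproj (φ.mdifferentiableAt_localSection hx)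
  -- The section identity holds only over `baseSet`; openness makes it an identity of germs at `x`,
  -- which is enough for the derivative.
  have heq : proj ∘ φ.localSection =ᶠ[nhds x] id :=
    Filter.eventuallyEq_of_mem (φ.open_baseSet.mem_nhds hx) fun y hy ↦ φ.proj_localSection hy
  have hid := ((hasMFDerivAt_id (I := IX) x).congr_of_eventuallyEq heq).mfderiv
  exact (DFunLike.congr_fun hcomp u).symm.trans (DFunLike.congr_fun hid u)

/-- A vertical vector at a point of the local section is tangent to the orbit. -/
theorem exists_mfderiv_act_eq (hact : ∀ p g, proj (act p g) = proj p) {x : X}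
    (hx : x ∈ φ.baseSet) (v : TangentSpace IP (φ.localSection x))
    (hv : mfderiv IP IX proj (φ.localSection x) v = 0) :
    ∃ A : GroupLieAlgebra IG G,
      (mfderiv IG IP (fun g : G ↦ act (φ.localSection x) g) 1 A : EP) = v := by
  let p := φ.localSection x
  have hps : p ∈ φ.source := φ.localSection_mem_source hx
  have hφp : φ.toFun p = (x, 1) := φ.toFun_localSection hx
  have hφ := φ.mdifferentiableAt_toFun hps
  have hinv := φ.mdifferentiableAt_invFun hx 1
  have hinv' : MDifferentiableAt (IX.prod IG) IP φ.invFun (φ.toFun p) := by rwa [hφp]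
  -- In the trivialization `v` becomes a pair: the base component is `dπ v = 0`, and the fibre
  -- component is the desired Lie algebra element, since `φ (σ x) = (x, 1)`.
  let w : EX × EG := mfderiv IP (IX.prod IG) φ.toFun p v
  have hw₁ : w.1 = 0 := by
    have heq : (Prod.fst ∘ φ.toFun) =ᶠ[nhds p] proj :=
      Filter.eventuallyEq_of_mem (φ.open_source.mem_nhds hps) fun q hq ↦ φ.proj_toFun q hq
    have hd := ((hasMFDerivAt_fst (I := IX) (I' := IG) (φ.toFun p)).comp p
      hφ.hasMFDerivAt).congr_of_eventuallyEq heq.symm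
    have h := DFunLike.congr_fun hd.mfderiv v
    exact h.symm.trans hv
  have hwv : (mfderiv (IX.prod IG) IP φ.invFun (x, (1 : G)) w : EP) = v := by
    have heq : φ.invFun ∘ φ.toFun =ᶠ[nhds p] id :=
      Filter.eventuallyEq_of_mem (φ.open_source.mem_nhds hps) fun q hq ↦ φ.left_inv' hq
    have hid := ((hasMFDerivAt_id (I := IP) p).congr_of_eventuallyEq heq).mfderiv
    have hcomp := mfderiv_comp p hinv' hφ
    have h := (DFunLike.congr_fun hcomp v).symm.trans (DFunLike.congr_fun hid v)
    rw [← hφp]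
    exact h
  refine ⟨w.2, ?_⟩
  have hfun : (fun g : G ↦ act p g) = φ.invFun ∘ fun g : G ↦ (x, g) :=
    funext fun g ↦ φ.act_localSection hact hx g
  -- The slice `g ↦ (x, g)` has derivative `A ↦ (0, A)` at `1`, so it sends `w.2` to `w` because
  -- `w.1 = 0`.
  have hslice := (hasMFDerivAt_const (I := IG) (I' := IX) x (1 : G)).prodMk
    (hasMFDerivAt_id (I := IG) (1 : G))
  have hd := HasMFDerivAt.comp (1 : G) (f := fun g : G ↦ (x, g)) hinv.hasMFDerivAt hslice
  have h := DFunLike.congr_fun hd.mfderiv w.2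
  rw [hfun]
  refine h.trans ?_
  refine Eq.trans ?_ hwv
  have hw : w = ((0 : EX), w.2) := Prod.ext hw₁ rfl
  exact congrArg (fun z : EX × EG ↦ (mfderiv (IX.prod IG) IP φ.invFun (x, (1 : G)) z : EP)) hw.symm

end PrincipalTrivialization

variable [IsManifold IP ∞ P] {B : PrincipalBundle X G P IX IG IP}

/-- Any two connections agree on the vertical vectors along a local section. -/
theorem PrincipalBundle.Connection.form_eq_of_vertical (θ θ' : B.Connection)
    (φ : B.LocalTrivialization) {x : X} (hx : x ∈ φ.baseSet)
    (v : TangentSpace IP (φ.localSection x))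
    (hv : mfderiv IP IX B.proj (φ.localSection x) v = 0) :
    θ.form (φ.localSection x) v = θ'.form (φ.localSection x) v := by
  obtain ⟨A, hA⟩ := φ.exists_mfderiv_act_eq B.proj_act hx v hv
  have hA' : B.fundamentalVectorField A (φ.localSection x) = v := hA
  rw [← hA', θ.fundamental, θ'.fundamental]

variable [IsManifold IX ∞ X]

/-- The correction term is the value of the connection on the difference of the
push-forward `dσ ξ` and the given lift of `ξ`. -/
theorem PrincipalBundle.LinearLift.correctionTerm_eq (L : B.LinearLift) (θ : B.Connection)
    (ξ : SmoothVectorField X IX) (φ : B.LocalTrivialization) (x : X) :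
    L.correctionTerm θ ξ φ x = θ.form (φ.localSection x)
      (mfderiv IX IP φ.localSection x (ξ x) -
        (L.toLinearMap ξ : SmoothVectorField P IP) (φ.localSection x)) :=
  (map_sub (θ.form (φ.localSection x)) _ _).symm

/-- Verticality: `dσ (ξ x)` projects to `ξ x` because `π ∘ σ = id` near `x`, and the lift does so by
definition. -/
theorem PrincipalBundle.LinearLift.mfderiv_proj_sub (L : B.LinearLift)
    (ξ : SmoothVectorField X IX) (φ : B.LocalTrivialization) {x : X} (hx : x ∈ φ.baseSet) :
    mfderiv IP IX B.proj (φ.localSection x) (mfderiv IX IP φ.localSection x (ξ x) -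
      (L.toLinearMap ξ : SmoothVectorField P IP) (φ.localSection x)) = 0 := by
  have h₁ := φ.mfderiv_proj_mfderiv_localSection hx
    (B.contMDiff_proj.mdifferentiableAt (by simp)) (ξ x)
  -- The two values lie in tangent spaces at points that are only propositionally equal, so they are
  -- compared in the model space `EX`.
  have h₂ : (ξ (B.proj (φ.localSection x)) : EX) = ξ x :=
    congrArg (fun y ↦ (ξ y : EX)) (φ.proj_localSection hx)
  rw [map_sub, L.mfderiv_proj]
  exact sub_eq_zero.mpr (h₁.trans h₂.symm)

end

end GaugeGeometry

/-- For a fixed `ℝ`-linear lift of vector fields to a principal bundle, the covariantization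
correction term `ι_ξ ω - λ^ω_ξ` is, in every local trivialization, the same for all connections. -/
theorem mainTheorem10
    {EX HX X EG HG G EP HP P : Type*}
    [NormedAddCommGroup EX] [NormedSpace ℝ EX] [FiniteDimensional ℝ EX] [TopologicalSpace HX]
    {IX : ModelWithCorners ℝ EX HX} [IX.Boundaryless]
    [TopologicalSpace X] [ChartedSpace HX X] [IsManifold IX ∞ X]
    [NormedAddCommGroup EG] [NormedSpace ℝ EG] [FiniteDimensional ℝ EG] [TopologicalSpace HG]
    {IG : ModelWithCorners ℝ EG HG} [IG.Boundaryless]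
    [TopologicalSpace G] [ChartedSpace HG G] [Group G] [LieGroup IG ∞ G]
    [NormedAddCommGroup EP] [NormedSpace ℝ EP] [FiniteDimensional ℝ EP] [TopologicalSpace HP]
    {IP : ModelWithCorners ℝ EP HP} [IP.Boundaryless]
    [TopologicalSpace P] [ChartedSpace HP P] [IsManifold IP ∞ P]
    (B : GaugeGeometry.PrincipalBundle X G P IX IG IP)
    (L : B.LinearLift) (θ θ' : B.Connection)
    (ξ : GaugeGeometry.SmoothVectorField X IX)
    (φ : B.LocalTrivialization) (x : X) (hx : x ∈ φ.baseSet) :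
    L.correctionTerm θ ξ φ x = L.correctionTerm θ' ξ φ x := by
  rw [L.correctionTerm_eq, L.correctionTerm_eq]
  exact θ.form_eq_of_vertical θ' φ hx _ (L.mfderiv_proj_sub ξ φ hx)
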